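/- Let $\mathbb H^n$ be hyperbolic space of constant sectional curvature $-1$ with Riemannian distance $d$, let $\gamma,\eta:[0,1]\to\mathbb H^n$ be unit speed geodesic segments, and put $\varphi(r,s)=d(\gamma(s),\eta(r))$ for $(r,s)\in[0,1]^2$. There are absolute constants $c>0$ and $\lambda_0>1$ (independent of $n,\gamma,\eta$) such that the following holds for every $\lambda\ge\lambda_0$. Suppose that $\sinh\varphi\ge 64$ and $\coth\varphi\le 3/2$ on $[0,1/4]^2$, and that $(r_1,s_1)\in[0,1/4]^2$ satisfies $|\partial_r\varphi(r_1,s_1)|\le(\log\lambda)^{-4}$. Then: 1. $|\partial_r\varphi(r,s)|\ge c(\log\lambda)^{-3}$ for every $(r,s)\in[0,1/4]^2$ with $|r-r_1|\ge\max\left(\tfrac12|s-s_1|,(\log\lambda)^{-3}\right)$. 2. (Near-joint critical points are isolated.) If in addition $|\partial_s\varphi(r_1,s_1)|\le(\log\lambda)^{-4}$, then every $(r,s)\in[0,1/4]^2$ with $|\partial_r\varphi(r,s)|\le(\log\lambda)^{-4}$ and $|\partial_s\varphi(r,s)|\le(\log\lambda)^{-4}$ satisfies $|r-r_1|<(\log\lambda)^{-3}$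 and $|s-s_1|<(\log\lambda)^{-3}$. (Derivatives at boundary points are one-sided.) -/

import Mathlib

open Set

noncomputable section

namespace HypGeom

/-- The vector space underlying Minkowski space `ℝ^{1,n}`: a time coordinate and `n` space
coordinates. -/
abbrev Mink (n : ℕ) : Type := ℝ × EuclideanSpace ℝ (Fin n)

/-- The Lorentz form `⟨x, y⟩ = ∑ xᵢ yᵢ - x₀ y₀` of signature `(n, 1)`. -/
def lorentz {n : ℕ} (x y : Mink n) : ℝ := inner ℝ x.2 y.2 - x.1 * y.1

/-- Hyperbolic space `ℍⁿ` (constant sectional curvature `-1`): the upper sheet of the hyperboloid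
`⟨x, x⟩ = -1`, with the Riemannian metric that the Lorentz form induces on its tangent spaces
`{v | ⟨x, v⟩ = 0}`, on which that form is positive definite. -/
def hyperbolicSpace (n : ℕ) : Set (Mink n) := {x | lorentz x x = -1 ∧ 0 < x.1}

/-- Velocity of a curve parametrized by `[0, 1]` (one-sided at the endpoints). -/
def velocity {n : ℕ} (c : ℝ → Mink n) : ℝ → Mink n := derivWithin c (Icc 0 1)

/-- Riemannian norm of a tangent vector. -/
def rnorm {n : ℕ} (v : Mink n) : ℝ := Real.sqrt (lorentz v v)

/-- `c` restricted to `[0, 1]` is a `C¹` curve in `ℍⁿ` from `p` to `q`. -/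
structure IsCurveFromTo {n : ℕ} (c : ℝ → Mink n) (p q : Mink n) : Prop where
  contDiffOn : ContDiffOn ℝ 1 c (Icc 0 1)
  mapsTo : MapsTo c (Icc 0 1) (hyperbolicSpace n)
  source : c 0 = p
  target : c 1 = q

/-- Riemannian length of a curve parametrized by `[0, 1]`. -/
def curveLength {n : ℕ} (c : ℝ → Mink n) : ℝ := ∫ t in (0 : ℝ)..1, rnorm (velocity c t)

/-- Riemannian distance on `ℍⁿ`: the infimum of the lengths of the `C¹` curves from `p` to `q`. -/
def hypDist {n : ℕ} (p q : Mink n) : ℝ :=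
  sInf {L : ℝ | ∃ c : ℝ → Mink n, IsCurveFromTo c p q ∧ curveLength c = L}

/-- Projection of the ambient space onto the tangent space of `ℍⁿ` at `x`, orthogonal for the
Lorentz form. -/
def tangentProj {n : ℕ} (x w : Mink n) : Mink n := w + lorentz x w • x

/-- Covariant acceleration `D_t ċ` along a curve in `ℍⁿ`: as for every (semi-)Riemannian
submanifold of a flat space, the Levi-Civita derivative is the tangential part of the
ambient derivative. -/
def covAccel {n : ℕ} (c : ℝ → Mink n) (t : ℝ) : Mink n :=
  tangentProj (c t) (derivWithin (velocity c) (Icc 0 1) t)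

/-- `c` restricted to `[0, 1]` is a unit speed geodesic segment of `ℍⁿ`. Values of `c` outside
`[0, 1]` play no role. -/
structure IsUnitSpeedGeodesic {n : ℕ} (c : ℝ → Mink n) : Prop where
  contDiffOn : ContDiffOn ℝ 2 c (Icc 0 1)
  mapsTo : MapsTo c (Icc 0 1) (hyperbolicSpace n)
  unit_speed : ∀ t ∈ Icc (0 : ℝ) 1, rnorm (velocity c t) = 1
  geodesic : ∀ t ∈ Icc (0 : ℝ) 1, covAccel c t = 0

/-- The phase `φ(r, s) = d(γ(s), η(r))`. -/
def phase {n : ℕ} (γ η : ℝ → Mink n) (r s : ℝ) : ℝ := hypDist (γ s) (η r)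

/-- `∂_r φ(r, s)` for a function on `[0, 1]²` (one-sided on the boundary). -/
def partialR (φ : ℝ → ℝ → ℝ) (r s : ℝ) : ℝ := derivWithin (fun r' => φ r' s) (Icc 0 1) r

/-- `∂_s φ(r, s)` for a function on `[0, 1]²` (one-sided on the boundary). -/
def partialS (φ : ℝ → ℝ → ℝ) (r s : ℝ) : ℝ := derivWithin (fun s' => φ r s') (Icc 0 1) s

/-- Hyperbolic cotangent; used at positive arguments only. -/
def coth (x : ℝ) : ℝ := Real.cosh x / Real.sinh x

end HypGeom

end

open Set

/-! In the hyperboloid model `cosh φ = F`, where `F(r, s) = -⟨γ(s), η(r)⟩`, so `φ` can be studied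
through the bilinear form. The key quantity is `logSlope`, `F_r / F = tanh φ · ∂_r φ`. In `r`: the
geodesic equation `η'' = η` gives `F_rr = F`, so with `u` the slope at `r₁` and `h = r - r₁`, the
slope at `r` is `(u + tanh h) / (1 + u tanh h)`. If `|u| ≤ |h| / 100`, this is at least `2|h|/5` in
absolute value (`le_abs_logSlope`). In `s`: the slope has derivative a 2 × 2 minor over `F²`, at
most `1/F ≤ 1/64` in absolute value (`abs_logSlope_sub_le`). Moving `s` by at most `2|h|` therefore
costs at most `|h|/32`, and more than `|h|/5` survives (`le_abs_partialR`). The isolation of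
near-joint critical points follows by applying this bound also with `γ` and `η` exchanged: at least
one of the two cone conditions always holds. -/

namespace HypGeom

/-! ### Bilinearity of the Lorentz form -/

section LorentzForm

variable {n : ℕ} (x y z : Mink n) (a : ℝ)

lemma lorentz_comm : lorentz x y = lorentz y x := by
  simp only [lorentz, real_inner_comm, mul_comm]

lemma lorentz_add_left : lorentz (x + y) z = lorentz x z + lorentz y z := by
  simp only [lorentz, Prod.fst_add, Prod.snd_add, inner_add_left]; ring

lemma lorentz_add_right : lorentz x (y + z) = lorentz x y + lorentz x z := by
  rw [lorentz_comm, lorentz_add_left, lorentz_comm y, lorentz_comm z]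

lemma lorentz_smul_left : lorentz (a • x) y = a * lorentz x y := by
  simp only [lorentz, Prod.smul_fst, Prod.smul_snd, real_inner_smul_left, smul_eq_mul]; ring

lemma lorentz_smul_right : lorentz x (a • y) = a * lorentz x y := by
  rw [lorentz_comm, lorentz_smul_left, lorentz_comm]

lemma lorentz_sub_left : lorentz (x - y) z = lorentz x z - lorentz y z := by
  simp only [lorentz, Prod.fst_sub, Prod.snd_sub, inner_sub_left]; ring

lemma lorentz_sub_right : lorentz x (y - z) = lorentz x y - lorentz x z := by
  rw [lorentz_comm, lorentz_sub_left, lorentz_comm y, lorentz_comm z]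

@[simp] lemma lorentz_zero_left : lorentz 0 x = 0 := by simp [lorentz]

@[simp] lemma lorentz_zero_right : lorentz x 0 = 0 := by simp [lorentz]

end LorentzForm

/-! ### Positivity and Cauchy-Schwarz on tangent spaces -/

section TangentSpace

variable {n : ℕ} {p q x u v : Mink n}

lemma norm_sq_snd_eq (hx : x ∈ hyperbolicSpace n) : ‖x.2‖ ^ 2 = x.1 ^ 2 - 1 := by
  have h := hx.1
  rw [lorentz, real_inner_self_eq_norm_sq] at h
  linarith

/-- Quantitative positivity of the Lorentz form on the tangent spaces of `ℍⁿ`. -/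
lemma norm_sq_snd_le_of_tangent (hx : x ∈ hyperbolicSpace n) (hu : lorentz x u = 0) :
    ‖u.2‖ ^ 2 ≤ x.1 ^ 2 * lorentz u u := by
  have h1 := norm_sq_snd_eq hx
  have h2 : inner ℝ x.2 u.2 = x.1 * u.1 := by rw [lorentz] at hu; linarith
  have h3 := real_inner_mul_inner_self_le x.2 u.2
  rw [h2, real_inner_self_eq_norm_sq, real_inner_self_eq_norm_sq, h1] at h3
  rw [lorentz, real_inner_self_eq_norm_sq]
  linarith

lemma lorentz_self_nonneg_of_tangent (hx : x ∈ hyperbolicSpace n) (hu : lorentz x u = 0) :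
    0 ≤ lorentz u u := by
  have h := (sq_nonneg ‖u.2‖).trans (norm_sq_snd_le_of_tangent hx hu)
  exact nonneg_of_mul_nonneg_right h (pow_pos hx.2 2)

lemma eq_zero_of_tangent_of_lorentz_self_eq_zero (hx : x ∈ hyperbolicSpace n)
    (hu : lorentz x u = 0) (h0 : lorentz u u = 0) : u = 0 := by
  have h := norm_sq_snd_le_of_tangent hx hu
  rw [h0, mul_zero] at h
  have h2 : u.2 = 0 := by
    rw [← norm_eq_zero]; exact pow_eq_zero_iff two_ne_zero |>.1 (le_antisymm h (sq_nonneg _))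
  rw [lorentz, h2, inner_zero_right, zero_sub, neg_eq_zero] at hu
  exact Prod.ext ((mul_eq_zero.1 hu).resolve_left hx.2.ne') h2

/-- Cauchy-Schwarz inequality on the tangent spaces of `ℍⁿ`. -/
lemma lorentz_sq_le_of_tangent (hx : x ∈ hyperbolicSpace n) (hu : lorentz x u = 0)
    (hv : lorentz x v = 0) : lorentz u v ^ 2 ≤ lorentz u u * lorentz v v := by
  have key : ∀ t : ℝ, 0 ≤ lorentz v v * (t * t) + 2 * lorentz u v * t + lorentz u u := by
    intro t
    have h := lorentz_self_nonneg_of_tangent (u := u + t • v) hx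
      (by rw [lorentz_add_right, lorentz_smul_right, hu, hv]; ring)
    simp only [lorentz_add_left, lorentz_add_right, lorentz_smul_left, lorentz_smul_right,
      lorentz_comm v u] at h
    linarith
  have h := discrim_le_zero key
  rw [discrim] at h
  linarith

lemma neg_lorentz_pos (hp : p ∈ hyperbolicSpace n) (hq : q ∈ hyperbolicSpace n) :
    0 < -lorentz p q := by
  have h1 := norm_sq_snd_eq hp
  have h2 := norm_sq_snd_eq hq
  have h3 := real_inner_le_norm p.2 q.2
  have h4 : ‖p.2‖ < p.1 := lt_of_pow_lt_pow_left₀ 2 hp.2.le (by linarith)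
  have h5 : ‖q.2‖ < q.1 := lt_of_pow_lt_pow_left₀ 2 hq.2.le (by linarith)
  have h6 := mul_lt_mul'' h4 h5 (norm_nonneg _) (norm_nonneg _)
  rw [lorentz]; linarith

lemma one_le_neg_lorentz (hp : p ∈ hyperbolicSpace n) (hq : q ∈ hyperbolicSpace n) :
    1 ≤ -lorentz p q := by
  -- The tangential part of `q` at `p` has Lorentz square `⟨p, q⟩² - 1`.
  have h := lorentz_self_nonneg_of_tangent (u := q + lorentz p q • p) hp
    (by rw [lorentz_add_right, lorentz_smul_right, hp.1]; ring)
  simp only [lorentz_add_left, lorentz_add_right, lorentz_smul_left, lorentz_smul_right,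
    lorentz_comm q p, hp.1, hq.1] at h
  nlinarith [neg_lorentz_pos hp hq]

lemma eq_of_lorentz_eq_neg_one (hp : p ∈ hyperbolicSpace n) (hq : q ∈ hyperbolicSpace n)
    (h : lorentz p q = -1) : q = p := by
  refine sub_eq_zero.1 (eq_zero_of_tangent_of_lorentz_self_eq_zero hp ?_ ?_)
  · rw [lorentz_sub_right, h, hp.1]; ring
  · simp only [lorentz_sub_left, lorentz_sub_right, lorentz_comm q p, h, hp.1, hq.1]; ring

/-- The pairing of a fixed point with a tangent vector, estimated by Cauchy-Schwarz. -/
lemma lorentz_tangent_sq_le (hp : p ∈ hyperbolicSpace n) (hx : x ∈ hyperbolicSpace n)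
    (hv : lorentz x v = 0) :
    lorentz p v ^ 2 ≤ (lorentz p x ^ 2 - 1) * lorentz v v := by
  have h := lorentz_sq_le_of_tangent (u := p + lorentz p x • x) hx
    (by rw [lorentz_add_right, lorentz_smul_right, hx.1, lorentz_comm]; ring) hv
  simp only [lorentz_add_left, lorentz_add_right, lorentz_smul_left, lorentz_smul_right,
    lorentz_comm x p, hp.1, hx.1, hv] at h
  nlinarith

/-- The `2 × 2` minor of the Lorentz pairings between unit tangent frames along two curves. -/
lemma abs_lorentz_minor_le {y w : Mink n} (hx : x ∈ hyperbolicSpace n)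
    (hy : y ∈ hyperbolicSpace n) (hxv : lorentz x v = 0) (hyw : lorentz y w = 0)
    (hv : lorentz v v = 1) (hw : lorentz w w = 1) :
    |lorentz v w * lorentz x y - lorentz x w * lorentz v y| ≤ -lorentz x y := by
  have hpos := neg_lorentz_pos hx hy
  -- The minor is the pairing of `v` with `⟨x, y⟩ w - ⟨x, w⟩ y`, which is tangent at `x` and has
  -- Lorentz square `⟨x, y⟩² - ⟨x, w⟩²`.
  have h := lorentz_sq_le_of_tangent (u := v)
    (v := lorentz x y • w - lorentz x w • y) hx hxv
    (by rw [lorentz_sub_right, lorentz_smul_right, lorentz_smul_right]; ring)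
  simp only [lorentz_sub_left, lorentz_sub_right, lorentz_smul_left, lorentz_smul_right,
    lorentz_comm w y, hyw, hy.1, hv, hw] at h
  refine abs_le_of_sq_le_sq ?_ hpos.le
  nlinarith [sq_nonneg (lorentz x w)]

lemma HasDerivWithinAt.lorentz {c d : ℝ → Mink n} {c' d' : Mink n} {s : Set ℝ} {t : ℝ}
    (hc : HasDerivWithinAt c c' s t) (hd : HasDerivWithinAt d d' s t) :
    HasDerivWithinAt (fun τ => HypGeom.lorentz (c τ) (d τ))
      (HypGeom.lorentz (c t) d' + HypGeom.lorentz c' (d t)) s t := by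
  have fst : ∀ {e : ℝ → Mink n} {e' : Mink n}, HasDerivWithinAt e e' s t →
      HasDerivWithinAt (fun τ => (e τ).1) e'.1 s t := fun h =>
    (ContinuousLinearMap.fst ℝ ℝ (EuclideanSpace ℝ (Fin n))).hasFDerivAt.comp_hasDerivWithinAt t h
  have snd : ∀ {e : ℝ → Mink n} {e' : Mink n}, HasDerivWithinAt e e' s t →
      HasDerivWithinAt (fun τ => (e τ).2) e'.2 s t := fun h =>
    (ContinuousLinearMap.snd ℝ ℝ (EuclideanSpace ℝ (Fin n))).hasFDerivAt.comp_hasDerivWithinAt t h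
  have h := ((snd hc).inner ℝ (snd hd)).sub ((fst hc).mul (fst hd))
  refine h.congr_deriv ?_
  simp only [HypGeom.lorentz]; ring

end TangentSpace

/-! ### The Riemannian distance equals `arcosh (-⟨p, q⟩)` -/

section Distance

variable {n : ℕ} {p q : Mink n} {c : ℝ → Mink n}

lemma continuous_rnorm : Continuous (rnorm : Mink n → ℝ) := by
  unfold rnorm lorentz; fun_prop

lemma lorentz_velocity_eq_zero (hc : MapsTo c (Icc 0 1) (hyperbolicSpace n)) {t : ℝ}
    (ht : t ∈ Icc (0 : ℝ) 1) {v : Mink n} (hd : HasDerivWithinAt c v (Icc 0 1) t) :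
    lorentz (c t) v = 0 := by
  have h1 := HasDerivWithinAt.lorentz hd hd
  have h2 : HasDerivWithinAt (fun τ => lorentz (c τ) (c τ)) 0 (Icc 0 1) t :=
    (hasDerivWithinAt_const t _ (-1 : ℝ)).congr (fun τ hτ => (hc hτ).1) (hc ht).1
  have h3 := (uniqueDiffOn_Icc zero_lt_one t ht).eq_deriv _ h1 h2
  rw [lorentz_comm v] at h3
  linarith

/-- Integrates `(arcosh f)' ≤ ρ`. Since `arcosh` is not differentiable at `1`, where `f` starts in
the application, it is regularised to `log (f + √(f² - 1 + ε))`, with derivative `f' / √(f² - 1 +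
ε)`. -/
lemma log_sub_log_le_integral {f f' ρ : ℝ → ℝ} (hf1 : ∀ t ∈ Icc (0 : ℝ) 1, 1 ≤ f t)
    (hf : ∀ t ∈ Icc (0 : ℝ) 1, HasDerivWithinAt f (f' t) (Icc 0 1) t)
    (hρ : ContinuousOn ρ (Icc 0 1)) (hρ0 : ∀ t, 0 ≤ ρ t)
    (hff : ∀ t ∈ Icc (0 : ℝ) 1, f' t ^ 2 ≤ (f t ^ 2 - 1) * ρ t ^ 2) {ε : ℝ} (hε : 0 < ε) :
    Real.log (f 1 + √(f 1 ^ 2 - 1 + ε)) - Real.log (f 0 + √(f 0 ^ 2 - 1 + ε))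
      ≤ ∫ t in (0 : ℝ)..1, ρ t := by
  have hrad : ∀ t ∈ Icc (0 : ℝ) 1, 0 < f t ^ 2 - 1 + ε := fun t ht => by nlinarith [hf1 t ht]
  have hder : ∀ t ∈ Icc (0 : ℝ) 1,
      HasDerivWithinAt (fun τ => Real.log (f τ + √(f τ ^ 2 - 1 + ε)))
        (f' t / √(f t ^ 2 - 1 + ε)) (Icc 0 1) t := fun t ht => by
    have hs := Real.sqrt_pos.2 (hrad t ht)
    have h0 := hf1 t ht
    have hpos : 0 < f t + √(f t ^ 2 - 1 + ε) := by linarith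
    have h1 : HasDerivWithinAt (fun τ => √(f τ ^ 2 - 1 + ε)) _ (Icc 0 1) t :=
      ((((hf t ht).fun_pow 2).sub_const 1).add_const ε).sqrt (hrad t ht).ne'
    refine (((hf t ht).fun_add h1).log hpos.ne').congr_deriv ?_
    field_simp
    push_cast
    ring
  refine intervalIntegral.sub_le_integral_of_hasDeriv_right_of_le
    (g := fun τ => Real.log (f τ + √(f τ ^ 2 - 1 + ε)))
    (g' := fun t => f' t / √(f t ^ 2 - 1 + ε)) (φ := ρ) (zero_le_one' ℝ)
    (fun t ht => (hder t ht).continuousWithinAt)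
    (fun t ht => (hder t (Ioo_subset_Icc_self ht)).mono_of_mem_nhdsWithin
      (mem_nhdsWithin_of_mem_nhds (Icc_mem_nhds ht.1 ht.2)))
    (hρ.integrableOn_compact isCompact_Icc) (fun t ht => ?_)
  have ht' := Ioo_subset_Icc_self ht
  have hs := Real.sqrt_pos.2 (hrad t ht')
  rw [div_le_iff₀ hs]
  refine le_trans (le_abs_self _) (abs_le_of_sq_le_sq ?_ (mul_nonneg (hρ0 t) hs.le))
  rw [mul_pow, Real.sq_sqrt (hrad t ht').le]
  nlinarith [hff t ht', mul_nonneg hε.le (sq_nonneg (ρ t))]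

lemma log_sub_log_le_curveLength (hc : IsCurveFromTo c p q) {ε : ℝ} (hε : 0 < ε) :
    Real.log (-lorentz p q + √((-lorentz p q) ^ 2 - 1 + ε)) - Real.log (1 + √ε)
      ≤ curveLength c := by
  have hder : ∀ t ∈ Icc (0 : ℝ) 1, HasDerivWithinAt c (velocity c t) (Icc 0 1) t := fun t ht =>
    (hc.contDiffOn.differentiableOn one_ne_zero t ht).hasDerivWithinAt
  have hp : p ∈ hyperbolicSpace n := hc.source ▸ hc.mapsTo (left_mem_Icc.2 zero_le_one)
  have hfder : ∀ t ∈ Icc (0 : ℝ) 1, HasDerivWithinAt (fun t => -lorentz p (c t))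
      (-lorentz p (velocity c t)) (Icc 0 1) t := fun t ht => by
    have h := (HasDerivWithinAt.lorentz (hasDerivWithinAt_const t _ p) (hder t ht)).fun_neg
    refine h.congr_deriv ?_
    rw [lorentz_zero_left, add_zero]
  have hcont : ContinuousOn (fun t => rnorm (velocity c t)) (Icc 0 1) := by
    have hv : ContinuousOn (velocity c) (Icc 0 1) :=
      hc.contDiffOn.continuousOn_derivWithin (uniqueDiffOn_Icc zero_lt_one) le_rfl
    exact continuous_rnorm.comp_continuousOn hv
  have hsq : ∀ t ∈ Icc (0 : ℝ) 1, (-lorentz p (velocity c t)) ^ 2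
      ≤ ((-lorentz p (c t)) ^ 2 - 1) * rnorm (velocity c t) ^ 2 := fun t ht => by
    have htan := lorentz_velocity_eq_zero hc.mapsTo ht (hder t ht)
    have h := lorentz_tangent_sq_le hp (hc.mapsTo ht) htan
    have hr : rnorm (velocity c t) ^ 2 = lorentz (velocity c t) (velocity c t) :=
      Real.sq_sqrt (lorentz_self_nonneg_of_tangent (hc.mapsTo ht) htan)
    rw [hr]
    linarith
  have main := log_sub_log_le_integral (f := fun t => -lorentz p (c t))
    (f' := fun t => -lorentz p (velocity c t)) (ρ := fun t => rnorm (velocity c t))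
    (fun t ht => one_le_neg_lorentz hp (hc.mapsTo ht)) hfder hcont
    (fun t => Real.sqrt_nonneg _) hsq hε
  have h1 : (-lorentz p p) ^ 2 - 1 + ε = ε := by rw [hp.1]; ring
  simp only [hc.source, hc.target, h1] at main
  rwa [hp.1, neg_neg] at main

/-- The limit `ε → 0⁺` of the regularised bound. -/
lemma arcosh_le_curveLength (hc : IsCurveFromTo c p q) :
    Real.arcosh (-lorentz p q) ≤ curveLength c := by
  have hp : p ∈ hyperbolicSpace n := hc.source ▸ hc.mapsTo (left_mem_Icc.2 zero_le_one)
  have hq : q ∈ hyperbolicSpace n := hc.target ▸ hc.mapsTo (right_mem_Icc.2 zero_le_one)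
  have h1 := one_le_neg_lorentz hp hq
  have hcont : ContinuousAt (fun ε : ℝ =>
      Real.log (-lorentz p q + √((-lorentz p q) ^ 2 - 1 + ε)) - Real.log (1 + √ε)) 0 := by
    refine ContinuousAt.sub (ContinuousAt.log (by fun_prop) ?_) (ContinuousAt.log (by fun_prop) ?_)
    · have := Real.sqrt_nonneg ((-lorentz p q) ^ 2 - 1 + 0); positivity
    · simp
  have hlim := hcont.tendsto.mono_left (nhdsWithin_le_nhds (s := Ioi 0))
  have h := le_of_tendsto hlim
    (Filter.eventually_of_mem self_mem_nhdsWithin fun ε hε => log_sub_log_le_curveLength hc hε)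
  simpa [Real.arcosh] using h

lemma exists_curve_length_eq_arcosh (hp : p ∈ hyperbolicSpace n) (hq : q ∈ hyperbolicSpace n) :
    ∃ c : ℝ → Mink n, IsCurveFromTo c p q ∧ curveLength c = Real.arcosh (-lorentz p q) := by
  have h1 := one_le_neg_lorentz hp hq
  rcases h1.eq_or_lt with h | h
  · have hqp := eq_of_lorentz_eq_neg_one hp hq (by linarith)
    refine ⟨fun _ => p, ⟨contDiffOn_const, fun _ _ => hp, rfl, hqp.symm⟩, ?_⟩
    rw [← h, Real.arcosh_zero]
    simp [curveLength, velocity, rnorm]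
  · set L := Real.arcosh (-lorentz p q) with hL
    have hLpos : 0 < L := Real.arcosh_pos h
    have hch : Real.cosh L = -lorentz p q := Real.cosh_arcosh h1
    have hsh : 0 < Real.sinh L := Real.sinh_pos_iff.2 hLpos
    have hcs := Real.cosh_sq L
    -- `e` is the unit tangent vector at `p` pointing towards `q`; the minimiser is `cosh (tL) p +
    -- sinh (tL) e`.
    obtain ⟨e, he⟩ : ∃ e : Mink n, e = (Real.sinh L)⁻¹ • (q - Real.cosh L • p) := ⟨_, rfl⟩
    have hpe : lorentz p e = 0 := by
      rw [he, lorentz_smul_right, lorentz_sub_right, lorentz_smul_right, hp.1, hch]; ring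
    have hee : lorentz e e = 1 := by
      simp only [he, lorentz_smul_right, lorentz_smul_left, lorentz_sub_right, lorentz_sub_left,
        lorentz_comm q p, hp.1, hq.1]
      have : lorentz p q = -Real.cosh L := by linarith
      rw [this]
      field_simp
      linarith
    set c : ℝ → Mink n := fun t => Real.cosh (t * L) • p + Real.sinh (t * L) • e with hc
    have hcd : ∀ t, HasDerivAt c (L • (Real.sinh (t * L) • p + Real.cosh (t * L) • e)) t := by
      intro t
      have hm : HasDerivAt (fun t : ℝ => t * L) L t := by simpa using (hasDerivAt_id t).mul_const L
      refine ((hm.cosh.smul_const p).add (hm.sinh.smul_const e)).congr_deriv ?_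
      rw [smul_add, smul_smul, smul_smul, mul_comm L, mul_comm L]
    have hself : ∀ t, lorentz (c t) (c t) = -1 := by
      intro t
      simp only [hc, lorentz_add_left, lorentz_add_right, lorentz_smul_left, lorentz_smul_right,
        lorentz_comm e p, hpe, hee, hp.1]
      linarith [Real.cosh_sq (t * L)]
    have hspeed : ∀ t ∈ Icc (0 : ℝ) 1, rnorm (velocity c t) = L := by
      intro t ht
      rw [velocity, (hcd t).hasDerivWithinAt.derivWithin (uniqueDiffOn_Icc zero_lt_one t ht), rnorm]
      simp only [lorentz_add_left, lorentz_add_right, lorentz_smul_left, lorentz_smul_right,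
        lorentz_comm e p, hpe, hee, hp.1]
      rw [← Real.sqrt_sq hLpos.le]
      congr 1
      rw [Real.sqrt_sq hLpos.le]
      nlinarith [Real.cosh_sq (t * L)]
    have h0 : c 0 = p := by simp [hc]
    have hc1 : c 1 = q := by
      simp only [hc, he, one_mul]
      rw [smul_inv_smul₀ hsh.ne']
      abel
    refine ⟨c, ⟨?_, ?_, h0, hc1⟩, ?_⟩
    · have : ContDiff ℝ 1 c :=
        ((Real.contDiff_cosh.comp (contDiff_id.mul contDiff_const)).smul contDiff_const).add
          ((Real.contDiff_sinh.comp (contDiff_id.mul contDiff_const)).smul contDiff_const)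
      exact this.contDiffOn
    · intro t ht
      refine ⟨hself t, ?_⟩
      -- the time coordinate never vanishes on the hyperboloid and is positive at `0`
      have hne : ∀ τ ∈ Icc (0 : ℝ) t, (c τ).1 ≠ 0 := by
        intro τ _ h0
        have h := hself τ
        rw [lorentz, h0, mul_zero, sub_zero, real_inner_self_eq_norm_sq] at h
        nlinarith [sq_nonneg ‖(c τ).2‖]
      by_contra hcon
      have hcont : ContinuousOn (fun τ => (c τ).1) (Icc 0 t) := fun τ _ =>
        (continuous_fst.continuousAt.comp (hcd τ).continuousAt).continuousWithinAt
      obtain ⟨τ, hτ, hτ0⟩ := intermediate_value_Icc' ht.1 hcont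
        (show (0 : ℝ) ∈ Icc (c t).1 (c 0).1 from ⟨not_lt.1 hcon, by rw [h0]; exact hp.2.le⟩)
      exact hne τ hτ hτ0
    · rw [curveLength, intervalIntegral.integral_congr (g := fun _ => L)
        (fun t ht => hspeed t (by rwa [uIcc_of_le zero_le_one] at ht))]
      simp

/-- The Riemannian distance of `ℍⁿ` in the hyperboloid model. -/
theorem hypDist_eq_arcosh (hp : p ∈ hyperbolicSpace n) (hq : q ∈ hyperbolicSpace n) :
    hypDist p q = Real.arcosh (-lorentz p q) := by
  obtain ⟨c, hc, hlen⟩ := exists_curve_length_eq_arcosh hp hq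
  exact IsLeast.csInf_eq ⟨⟨c, hc, hlen⟩, fun _ ⟨_, hd, hL⟩ => hL ▸ arcosh_le_curveLength hd⟩

end Distance

variable {n : ℕ} {γ η c : ℝ → Mink n}

/-! ### Geodesics in the hyperboloid model -/

namespace IsUnitSpeedGeodesic

lemma hasDerivWithinAt (hc : IsUnitSpeedGeodesic c) {t : ℝ} (ht : t ∈ Icc (0 : ℝ) 1) :
    HasDerivWithinAt c (velocity c t) (Icc 0 1) t :=
  (hc.contDiffOn.differentiableOn two_ne_zero t ht).hasDerivWithinAt

lemma lorentz_velocity (hc : IsUnitSpeedGeodesic c) {t : ℝ} (ht : t ∈ Icc (0 : ℝ) 1) :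
    lorentz (c t) (velocity c t) = 0 :=
  lorentz_velocity_eq_zero hc.mapsTo ht (hc.hasDerivWithinAt ht)

lemma lorentz_velocity_self (hc : IsUnitSpeedGeodesic c) {t : ℝ} (ht : t ∈ Icc (0 : ℝ) 1) :
    lorentz (velocity c t) (velocity c t) = 1 := by
  have h := hc.unit_speed t ht
  rwa [rnorm, Real.sqrt_eq_one] at h

/-- In the hyperboloid model the geodesic equation is `c'' = c`. -/
lemma hasDerivWithinAt_velocity (hc : IsUnitSpeedGeodesic c) {t : ℝ} (ht : t ∈ Icc (0 : ℝ) 1) :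
    HasDerivWithinAt (velocity c) (c t) (Icc 0 1) t := by
  have hU : UniqueDiffOn ℝ (Icc (0 : ℝ) 1) := uniqueDiffOn_Icc zero_lt_one
  have hv : ContDiffOn ℝ 1 (velocity c) (Icc 0 1) := hc.contDiffOn.derivWithin hU (by norm_num)
  have hd := (hv.differentiableOn one_ne_zero t ht).hasDerivWithinAt
  -- Differentiating `⟨c, c'⟩ = 0` gives `⟨c, c''⟩ = -1`, so the tangential part of `c''` is `c'' -
  -- c`.
  have h1 := HasDerivWithinAt.lorentz (hc.hasDerivWithinAt ht) hd
  have h2 : HasDerivWithinAt (fun τ => lorentz (c τ) (velocity c τ)) 0 (Icc 0 1) t :=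
    (hasDerivWithinAt_const t _ (0 : ℝ)).congr (fun τ hτ => hc.lorentz_velocity hτ)
      (hc.lorentz_velocity ht)
  have h3 := (hU t ht).eq_deriv _ h1 h2
  rw [hc.lorentz_velocity_self ht] at h3
  have h4 := hc.geodesic t ht
  rw [covAccel, tangentProj, eq_neg_of_add_eq_zero_left h3, neg_one_smul] at h4
  rwa [← add_neg_eq_zero.1 h4]

/-- For `f' = g` and `g' = f` the left side has zero derivative in `t`, hence keeps its value at `t
= a`. This replaces a uniqueness theorem for `f'' = f`. -/
lemma cosh_smul_sub_eq {f g : ℝ → Mink n}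
    (hf : ∀ t ∈ Icc (0 : ℝ) 1, HasDerivWithinAt f (g t) (Icc 0 1) t)
    (hg : ∀ t ∈ Icc (0 : ℝ) 1, HasDerivWithinAt g (f t) (Icc 0 1) t)
    {a t : ℝ} (ha : a ∈ Icc (0 : ℝ) 1) (ht : t ∈ Icc (0 : ℝ) 1) :
    Real.cosh (t - a) • f t - Real.sinh (t - a) • g t = f a := by
  have hder : ∀ τ ∈ Icc (0 : ℝ) 1, HasDerivWithinAt
      (fun τ => Real.cosh (τ - a) • f τ - Real.sinh (τ - a) • g τ) 0 (Icc 0 1) τ := by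
    intro τ hτ
    have hm : HasDerivWithinAt (fun τ : ℝ => τ - a) 1 (Icc 0 1) τ :=
      (hasDerivWithinAt_id τ _).sub_const a
    refine ((hm.cosh.fun_smul (hf τ hτ)).fun_sub (hm.sinh.fun_smul (hg τ hτ))).congr_deriv ?_
    rw [mul_one, mul_one]
    abel
  have h := (convex_Icc (0 : ℝ) 1).norm_image_sub_le_of_norm_hasDerivWithin_le (C := 0) hder
    (fun τ _ => by rw [norm_zero]) ha ht
  rw [zero_mul, norm_le_zero_iff, sub_eq_zero] at h
  simpa using h

lemma eq_cosh_smul_add (hc : IsUnitSpeedGeodesic c) {a t : ℝ} (ha : a ∈ Icc (0 : ℝ) 1)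
    (ht : t ∈ Icc (0 : ℝ) 1) :
    c t = Real.cosh (t - a) • c a + Real.sinh (t - a) • velocity c a := by
  have h := cosh_smul_sub_eq (fun _ h => hc.hasDerivWithinAt h)
    (fun _ h => hc.hasDerivWithinAt_velocity h) ht ha
  rw [← neg_sub t a, Real.cosh_neg, Real.sinh_neg, neg_smul, sub_neg_eq_add] at h
  exact h.symm

lemma velocity_eq_cosh_smul_add (hc : IsUnitSpeedGeodesic c) {a t : ℝ} (ha : a ∈ Icc (0 : ℝ) 1)
    (ht : t ∈ Icc (0 : ℝ) 1) :
    velocity c t = Real.cosh (t - a) • velocity c a + Real.sinh (t - a) • c a := by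
  have h := cosh_smul_sub_eq (fun _ h => hc.hasDerivWithinAt_velocity h)
    (fun _ h => hc.hasDerivWithinAt h) ht ha
  rw [← neg_sub t a, Real.cosh_neg, Real.sinh_neg, neg_smul, sub_neg_eq_add] at h
  exact h.symm

end IsUnitSpeedGeodesic


/-! ### The phase and its logarithmic slope -/

lemma phase_eq_arcosh (hγ : IsUnitSpeedGeodesic γ) (hη : IsUnitSpeedGeodesic η) {r s : ℝ}
    (hr : r ∈ Icc (0 : ℝ) 1) (hs : s ∈ Icc (0 : ℝ) 1) :
    phase γ η r s = Real.arcosh (-lorentz (γ s) (η r)) :=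
  hypDist_eq_arcosh (hγ.mapsTo hs) (hη.mapsTo hr)

lemma phase_swap (hγ : IsUnitSpeedGeodesic γ) (hη : IsUnitSpeedGeodesic η) {r s : ℝ}
    (hr : r ∈ Icc (0 : ℝ) 1) (hs : s ∈ Icc (0 : ℝ) 1) : phase γ η r s = phase η γ s r := by
  rw [phase_eq_arcosh hγ hη hr hs, phase_eq_arcosh hη hγ hs hr, lorentz_comm]

lemma partialS_phase (hγ : IsUnitSpeedGeodesic γ) (hη : IsUnitSpeedGeodesic η) {r s : ℝ}
    (hr : r ∈ Icc (0 : ℝ) 1) (hs : s ∈ Icc (0 : ℝ) 1) :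
    partialS (phase γ η) r s = partialR (phase η γ) s r :=
  derivWithin_congr (fun _ hs' => phase_swap hγ hη hr hs') (phase_swap hγ hη hr hs)

lemma le_neg_lorentz_of_le_sinh_phase (hγ : IsUnitSpeedGeodesic γ) (hη : IsUnitSpeedGeodesic η)
    {r s : ℝ} (hr : r ∈ Icc (0 : ℝ) 1) (hs : s ∈ Icc (0 : ℝ) 1) {M : ℝ}
    (h : M ≤ Real.sinh (phase γ η r s)) : M ≤ -lorentz (γ s) (η r) := by
  have h1 := one_le_neg_lorentz (hγ.mapsTo hs) (hη.mapsTo hr)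
  have h2 := Real.sinh_lt_cosh (phase γ η r s)
  rw [phase_eq_arcosh hγ hη hr hs] at h h2
  rw [Real.cosh_arcosh h1] at h2
  linarith

lemma partialR_phase (hγ : IsUnitSpeedGeodesic γ) (hη : IsUnitSpeedGeodesic η) {r s : ℝ}
    (hr : r ∈ Icc (0 : ℝ) 1) (hs : s ∈ Icc (0 : ℝ) 1) (hF : 1 < -lorentz (γ s) (η r)) :
    partialR (phase γ η) r s =
      (√((-lorentz (γ s) (η r)) ^ 2 - 1))⁻¹ * -lorentz (γ s) (velocity η r) := by
  have h1 := (HasDerivWithinAt.lorentz (hasDerivWithinAt_const r _ (γ s))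
    (hη.hasDerivWithinAt hr)).fun_neg
  have h2 := (Real.hasDerivAt_arcosh (mem_Ioi.2 hF)).comp_hasDerivWithinAt r h1
  rw [lorentz_zero_left, add_zero] at h2
  have h3 : HasDerivWithinAt (fun r' => phase γ η r' s) _ (Icc 0 1) r :=
    h2.congr (fun r' hr' => phase_eq_arcosh hγ hη hr' hs) (phase_eq_arcosh hγ hη hr hs)
  exact h3.derivWithin (uniqueDiffOn_Icc zero_lt_one r hr)

/-- The logarithmic derivative `∂_r cosh φ / cosh φ = tanh φ · ∂_r φ` of `cosh φ`. -/
noncomputable def logSlope (γ η : ℝ → Mink n) (r s : ℝ) : ℝ :=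
  lorentz (γ s) (velocity η r) / lorentz (γ s) (η r)

/-- This is `tanh φ ≤ 1`. The same direction serves twice: smallness of `∂_r φ` passes to the slope
at the base point, and a lower bound on the slope passes back to `∂_r φ` at the other point. -/
lemma abs_logSlope_le (hγ : IsUnitSpeedGeodesic γ) (hη : IsUnitSpeedGeodesic η) {r s : ℝ}
    (hr : r ∈ Icc (0 : ℝ) 1) (hs : s ∈ Icc (0 : ℝ) 1) (hF : 1 < -lorentz (γ s) (η r)) :
    |logSlope γ η r s| ≤ |partialR (phase γ η) r s| := by
  have hpos : 0 < (-lorentz (γ s) (η r)) ^ 2 - 1 := by nlinarith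
  have hle : √((-lorentz (γ s) (η r)) ^ 2 - 1) ≤ -lorentz (γ s) (η r) :=
    Real.sqrt_le_iff.2 ⟨by linarith, by linarith⟩
  rw [partialR_phase hγ hη hr hs hF, logSlope, abs_div, abs_mul, abs_inv, abs_neg,
    abs_of_pos (Real.sqrt_pos.2 hpos), ← abs_neg (lorentz (γ s) (η r)),
    abs_of_pos (by linarith : 0 < -lorentz (γ s) (η r)), div_eq_inv_mul]
  gcongr

/-- The mixed second derivative is small where `cosh φ` is large. -/
lemma abs_logSlope_sub_le (hγ : IsUnitSpeedGeodesic γ) (hη : IsUnitSpeedGeodesic η) {r : ℝ}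
    (hr : r ∈ Icc (0 : ℝ) 1) {S : Set ℝ} (hS : S ⊆ Icc 0 1) (hSc : Convex ℝ S) {M : ℝ}
    (hM : 0 < M) (hF : ∀ s ∈ S, M ≤ -lorentz (γ s) (η r)) {s s₁ : ℝ} (hs : s ∈ S)
    (hs₁ : s₁ ∈ S) : |logSlope γ η r s - logSlope γ η r s₁| ≤ M⁻¹ * |s - s₁| := by
  have hder : ∀ τ ∈ S, HasDerivWithinAt (fun τ => logSlope γ η r τ)
      ((lorentz (velocity γ τ) (velocity η r) * lorentz (γ τ) (η r) -
        lorentz (γ τ) (velocity η r) * lorentz (velocity γ τ) (η r)) / lorentz (γ τ) (η r) ^ 2)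
      S τ := by
    intro τ hτ
    have hd := (hγ.hasDerivWithinAt (hS hτ)).mono hS
    have h1 := HasDerivWithinAt.lorentz hd (hasDerivWithinAt_const τ _ (velocity η r))
    have h2 := HasDerivWithinAt.lorentz hd (hasDerivWithinAt_const τ _ (η r))
    rw [lorentz_zero_right, zero_add] at h1 h2
    exact h1.fun_div h2 (by have := hF τ hτ; intro h0; linarith)
  refine hSc.norm_image_sub_le_of_norm_hasDerivWithin_le hder (fun τ hτ => ?_) hs₁ hs
  have h := abs_lorentz_minor_le (hγ.mapsTo (hS hτ)) (hη.mapsTo hr) (hγ.lorentz_velocity (hS hτ))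
    (hη.lorentz_velocity hr) (hγ.lorentz_velocity_self (hS hτ)) (hη.lorentz_velocity_self hr)
  have hFτ := hF τ hτ
  have hX : 0 < -lorentz (γ τ) (η r) := hM.trans_le hFτ
  rw [Real.norm_eq_abs, abs_div, abs_of_nonneg (sq_nonneg (lorentz (γ τ) (η r)))]
  calc _ ≤ -lorentz (γ τ) (η r) / lorentz (γ τ) (η r) ^ 2 := by gcongr
    _ = (-lorentz (γ τ) (η r))⁻¹ := by
      rw [← neg_sq, pow_two, div_mul_cancel_left₀ hX.ne']
    _ ≤ M⁻¹ := by gcongr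

/-- With `u = Y / X` the quotient is `(u cosh h + sinh h) / (cosh h + u sinh h)`. As `cosh h ≤ 2`
and `|sinh h| ≥ |h|`, the numerator is at least `98|h|/100` in size and the denominator at most `2 +
2/400`. -/
lemma le_abs_sinh_cosh_div {X Y h : ℝ} (hX : X ≠ 0) (hh : |h| ≤ 1 / 4)
    (hY : |Y / X| ≤ |h| / 100) :
    2 / 5 * |h| ≤ |(Real.cosh h * Y + Real.sinh h * X) / (Real.cosh h * X + Real.sinh h * Y)| := by
  set u := Y / X with hu
  have hYX : Y = u * X := by rw [hu, div_mul_cancel₀ _ hX]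
  have hcosh : Real.cosh h ≤ 2 := by
    have h1 := Real.cosh_le_exp_half_sq h
    have h2 : h ^ 2 / 2 ≤ 1 / 2 := by
      have := sq_abs h
      nlinarith [abs_nonneg h]
    have h3 := Real.exp_bound_div_one_sub_of_interval (x := h ^ 2 / 2) (by positivity)
      (by linarith)
    have h4 : 1 / (1 - h ^ 2 / 2) ≤ 2 := by rw [div_le_iff₀ (by linarith)]; linarith
    linarith
  have hcpos := Real.cosh_pos h
  have hsinh : |h| ≤ |Real.sinh h| := by
    rw [Real.abs_sinh]; exact Real.self_le_sinh_iff.2 (abs_nonneg h)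
  have hsc : |Real.sinh h| ≤ Real.cosh h := by
    rw [Real.abs_sinh, ← Real.cosh_abs]; exact (Real.sinh_lt_cosh _).le
  have hnum : 98 / 100 * |h| ≤ |Real.cosh h * u + Real.sinh h| := by
    have h1 := abs_sub_abs_le_abs_add (Real.sinh h) (Real.cosh h * u)
    rw [abs_mul, abs_of_pos hcpos, add_comm] at h1
    nlinarith [abs_nonneg u]
  have hsu : |Real.sinh h * u| ≤ Real.cosh h * (1 / 400) := by
    rw [abs_mul]
    exact mul_le_mul hsc (by linarith) (abs_nonneg u) hcpos.le
  have hden : 0 < Real.cosh h + Real.sinh h * u := by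
    linarith [(abs_le.1 hsu).1]
  have hden' : Real.cosh h + Real.sinh h * u ≤ 401 / 200 := by
    linarith [(abs_le.1 hsu).2]
  have heq : (Real.cosh h * Y + Real.sinh h * X) / (Real.cosh h * X + Real.sinh h * Y) =
      (Real.cosh h * u + Real.sinh h) / (Real.cosh h + Real.sinh h * u) := by
    rw [← mul_div_mul_right (Real.cosh h * u + Real.sinh h) _ hX, hYX]
    ring_nf
  rw [heq, abs_div, abs_of_pos hden, le_div_iff₀ hden]
  nlinarith [abs_nonneg h]

lemma le_abs_logSlope (hη : IsUnitSpeedGeodesic η) {r r₁ s : ℝ} (hr : r ∈ Icc (0 : ℝ) 1)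
    (hr₁ : r₁ ∈ Icc (0 : ℝ) 1) (hF : lorentz (γ s) (η r₁) ≠ 0) (hrr : |r - r₁| ≤ 1 / 4)
    (h : |logSlope γ η r₁ s| ≤ |r - r₁| / 100) : 2 / 5 * |r - r₁| ≤ |logSlope γ η r s| := by
  have := le_abs_sinh_cosh_div hF hrr h
  rwa [logSlope, hη.eq_cosh_smul_add hr₁ hr, hη.velocity_eq_cosh_smul_add hr₁ hr,
    lorentz_add_right, lorentz_add_right, lorentz_smul_right, lorentz_smul_right,
    lorentz_smul_right, lorentz_smul_right]

/-- Away from a near-critical point of `r ↦ φ(r, s₁)`, the derivative `∂_r φ` is bounded below. -/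
theorem le_abs_partialR (hγ : IsUnitSpeedGeodesic γ) (hη : IsUnitSpeedGeodesic η)
    (hF : ∀ r ∈ Icc (0 : ℝ) (1 / 4), ∀ s ∈ Icc (0 : ℝ) (1 / 4), 64 ≤ -lorentz (γ s) (η r))
    {r s r₁ s₁ : ℝ} (hr : r ∈ Icc (0 : ℝ) (1 / 4)) (hs : s ∈ Icc (0 : ℝ) (1 / 4))
    (hr₁ : r₁ ∈ Icc (0 : ℝ) (1 / 4)) (hs₁ : s₁ ∈ Icc (0 : ℝ) (1 / 4))
    (h₁ : |partialR (phase γ η) r₁ s₁| ≤ |r - r₁| / 100) (hsr : |s - s₁| / 2 ≤ |r - r₁|) :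
    |r - r₁| / 5 ≤ |partialR (phase γ η) r s| := by
  have hsub : Icc (0 : ℝ) (1 / 4) ⊆ Icc 0 1 := Icc_subset_Icc_right (by norm_num)
  have hF₁ := hF r₁ hr₁ s₁ hs₁
  have h2 := abs_logSlope_le hγ hη (hsub hr₁) (hsub hs₁) (by linarith)
  have h3 := abs_logSlope_le hγ hη (hsub hr) (hsub hs) (by linarith [hF r hr s hs])
  have hrr : |r - r₁| ≤ 1 / 4 := abs_le.2 ⟨by linarith [hr.1, hr₁.2], by linarith [hr.2, hr₁.1]⟩
  -- The path goes from `(r₁, s₁)` to `(r, s₁)`, where the slope grows, then to `(r, s)`, where it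
  -- loses at most `|s - s₁| / 64`.
  have h4 := le_abs_logSlope (γ := γ) hη (hsub hr) (hsub hr₁) (s := s₁)
    (fun h0 => by linarith) hrr (h2.trans h₁)
  have h5 := abs_logSlope_sub_le hγ hη (hsub hr) hsub (convex_Icc _ _) (by norm_num)
    (fun s hs => hF r hr s hs) hs₁ hs
  have h6 := abs_sub_abs_le_abs_sub (logSlope γ η r s₁) (logSlope γ η r s)
  rw [abs_sub_comm s₁ s] at h5
  linarith [abs_nonneg (r - r₁)]

end HypGeom

/-! ### The theorem -/

theorem lemmaT :
    ∃ c : ℝ, 0 < c ∧ ∃ lam₀ : ℝ, 1 < lam₀ ∧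
      ∀ (n : ℕ) (γ η : ℝ → HypGeom.Mink n),
        HypGeom.IsUnitSpeedGeodesic γ → HypGeom.IsUnitSpeedGeodesic η →
        (∀ r ∈ Set.Icc (0 : ℝ) (1 / 4), ∀ s ∈ Set.Icc (0 : ℝ) (1 / 4),
          64 ≤ Real.sinh (HypGeom.phase γ η r s) ∧
            HypGeom.coth (HypGeom.phase γ η r s) ≤ 3 / 2) →
        ∀ lam : ℝ, lam₀ ≤ lam →
        ∀ r₁ ∈ Set.Icc (0 : ℝ) (1 / 4), ∀ s₁ ∈ Set.Icc (0 : ℝ) (1 / 4),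
          |HypGeom.partialR (HypGeom.phase γ η) r₁ s₁| ≤ Real.log lam ^ (-4 : ℤ) →
          (∀ r ∈ Set.Icc (0 : ℝ) (1 / 4), ∀ s ∈ Set.Icc (0 : ℝ) (1 / 4),
            max (|s - s₁| / 2) (Real.log lam ^ (-3 : ℤ)) ≤ |r - r₁| →
            c * Real.log lam ^ (-3 : ℤ) ≤ |HypGeom.partialR (HypGeom.phase γ η) r s|) ∧
          (|HypGeom.partialS (HypGeom.phase γ η) r₁ s₁| ≤ Real.log lam ^ (-4 : ℤ) →
            ∀ r ∈ Set.Icc (0 : ℝ) (1 / 4), ∀ s ∈ Set.Icc (0 : ℝ) (1 / 4),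
              |HypGeom.partialR (HypGeom.phase γ η) r s| ≤ Real.log lam ^ (-4 : ℤ) →
              |HypGeom.partialS (HypGeom.phase γ η) r s| ≤ Real.log lam ^ (-4 : ℤ) →
              |r - r₁| < Real.log lam ^ (-3 : ℤ) ∧ |s - s₁| < Real.log lam ^ (-3 : ℤ)) := by
  -- `λ₀ = exp 100` forces `log λ ≥ 100`, so `(log λ)⁻⁴ ≤ (log λ)⁻³ / 100`, the smallness that
  -- `le_abs_partialR` needs.
  refine ⟨1 / 5, by norm_num, Real.exp 100, Real.one_lt_exp_iff.2 (by norm_num), ?_⟩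
  intro n γ η hγ hη hφ lam hlam r₁ hr₁ s₁ hs₁ h₁
  have hsub : Set.Icc (0 : ℝ) (1 / 4) ⊆ Set.Icc 0 1 := Set.Icc_subset_Icc_right (by norm_num)
  have hF : ∀ r ∈ Set.Icc (0 : ℝ) (1 / 4), ∀ s ∈ Set.Icc (0 : ℝ) (1 / 4),
      64 ≤ -HypGeom.lorentz (γ s) (η r) := fun r hr s hs =>
    HypGeom.le_neg_lorentz_of_le_sinh_phase hγ hη (hsub hr) (hsub hs) (hφ r hr s hs).1
  have hF' : ∀ s ∈ Set.Icc (0 : ℝ) (1 / 4), ∀ r ∈ Set.Icc (0 : ℝ) (1 / 4),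
      64 ≤ -HypGeom.lorentz (η r) (γ s) := fun s hs r hr => by
    rw [HypGeom.lorentz_comm]; exact hF r hr s hs
  have hlog : 100 ≤ Real.log lam := (Real.le_log_iff_exp_le ((Real.exp_pos _).trans_le hlam)).2 hlam
  set δ := Real.log lam ^ (-3 : ℤ) with hδ
  have hδ0 : 0 < δ := zpow_pos (by linarith) _
  have hκ : Real.log lam ^ (-4 : ℤ) ≤ δ / 100 := by
    rw [show (-4 : ℤ) = -3 - 1 by norm_num, zpow_sub_one₀ (by linarith), ← hδ, div_eq_mul_inv]
    gcongr
  refine ⟨fun r hr s hs hmax => ?_, fun h₁' r hr s hs h h' => ?_⟩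
  · obtain ⟨ha, hb⟩ := max_le_iff.1 hmax
    have := HypGeom.le_abs_partialR hγ hη hF hr hs hr₁ hs₁ (by linarith) ha
    linarith
  · rw [HypGeom.partialS_phase hγ hη (hsub hr₁) (hsub hs₁)] at h₁'
    rw [HypGeom.partialS_phase hγ hη (hsub hr) (hsub hs)] at h'
    have hR : |s - s₁| / 2 ≤ |r - r₁| → |r - r₁| < δ := fun hsr => by
      by_contra! hcon
      have := HypGeom.le_abs_partialR hγ hη hF hr hs hr₁ hs₁ (by linarith) hsr
      linarith
    have hS : |r - r₁| / 2 ≤ |s - s₁| → |s - s₁| < δ := fun hsr => by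
      by_contra! hcon
      have := HypGeom.le_abs_partialR hη hγ hF' hs hr hs₁ hr₁ (by linarith) hsr
      linarith
    have hr0 := abs_nonneg (r - r₁)
    have hs0 := abs_nonneg (s - s₁)
    constructor
    · by_contra! hcon
      -- If the cone condition for `r` fails, then `|r - r₁| < |s - s₁| / 2`, so the one for `s`
      -- holds and `|r - r₁| < δ / 2`.
      rcases le_or_gt (|s - s₁| / 2) |r - r₁| with h2 | h2
      · linarith [hR h2]
      · linarith [hS (by linarith)]
    · by_contra! hcon
      rcases le_or_gt (|r - r₁| / 2) |s - s₁| with h2 | h2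
      · linarith [hS h2]
      · linarith [hR (by linarith)]
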